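/- Theorem 4. Consider a discrete-time G/G/$\infty$ queue: packets $i=0,1,2,\dots$ are generated at the times $Z_i=\sum_{k=0}^{i-1}X_k$ (the beginnings of the slots $Z_i$), each packet is assigned its own server on arrival, and packet $i$ needs $S_i$ time-slots of service, so that it is served at the end of slot $Z_i+S_i-1$. The inter-generation times $(X_k)_{k\ge 0}$ are i.i.d. and the service times $(S_k)_{k\ge 0}$ are i.i.d., both with values in $\{1,2,3,\dots\}$ and otherwise arbitrary distributions, the two sequences are independent of each other, and $\mathbb{E}[X]<\infty$, where $X$ denotes a generic inter-generation time. Let $A(t)$ be the age of information at the beginning of slot $t$: $A(0)\in\{0,1,2,\dots\}$ is an arbitrary constant, $A(t+1)=A(t)+1$ if no packet is served in slot $t$, and otherwise $A(t+1)=\min\{A(t),\,t-Z_i\}+1$, where the minimum extends over all packets $i$ served in slot $t$. Then the average age $$A^{\mathrm{ave}}=\limsup_{T\to\infty}\frac1T\sum_{t=1}^{T}A(t)$$ satisfies, almost surely, $$A^{\mathrm{ave}}=\frac12\,\frac{\mathbb{E}[X^2]}{\mathbb{E}[X]}+\mathbb{E}\Big[\min_{l\ge 0}\Big\{\sum_{k=1}^{l}X_k+S_{l+1}\Big\}\Big]-\frac12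 ,$$ where both sides may be $+\infty$. -/

import Mathlib

open MeasureTheory ProbabilityTheory Filter
open scoped ENNReal

namespace AgeOfInfo

/-- Generation time (a time-slot) of packet `i`, when `x k` is the time between the generation of
packet `k` and that of packet `k + 1`; packet `0` is generated at time `0`. -/
def genTime (x : ℕ → ℕ) (i : ℕ) : ℕ :=
  ∑ k ∈ Finset.range i, x k

/-- In the infinite server queue every packet gets its own server on arrival. Packet `i` arrives at
the beginning of slot `genTime x i`, occupies its server for `s i ≥ 1` slots, and hence is
served at the end of slot `genTime x i + s i - 1`. -/
def ServedAt (x s : ℕ → ℕ) (i t : ℕ) : Prop :=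
  genTime x i + s i = t + 1

/-- The age at the beginning of each slot, from the age `a₀` at the beginning of slot `0`:
`A (t + 1) = A t + 1` if no packet is served in slot `t`, and otherwise `A (t + 1)` is
one plus the minimum of `A t` and of the values `t - genTime x i`, over the packets `i` served in
slot `t`. (`sInf` of a nonempty set of natural numbers is its minimum; and
`genTime x i ≤ t` for these packets, as `1 ≤ s i`.) -/
noncomputable def age (x s : ℕ → ℕ) (a₀ : ℕ) : ℕ → ℕ
  | 0 => a₀
  | t + 1 => sInf (insert (age x s a₀ t) {a | ∃ i, ServedAt x s i t ∧ a = t - genTime x i}) + 1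

/-- The average age `limsup_{T → ∞} (1 / T) ∑_{t = 1}^{T} A t`, with values in `[-∞, ∞]`. -/
noncomputable def averageAge (A : ℕ → ℕ) : EReal :=
  limsup (fun T : ℕ => (((1 / (T : ℝ)) * ∑ t ∈ Finset.Icc 1 T, (A t : ℝ) : ℝ) : EReal)) atTop

/-- `min_{l ≥ 0} (∑_{k = 1}^{l} x k + s (l + 1))`. -/
noncomputable def minDelay (x s : ℕ → ℕ) : ℕ :=
  sInf (Set.range fun l : ℕ => ∑ k ∈ Finset.Icc 1 l, x k + s (l + 1))

/-- The expectation, in `[0, ∞]`, of a random variable with values in the natural numbers. -/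
noncomputable def expect {Ω : Type*} [MeasurableSpace Ω] (P : Measure Ω) (f : Ω → ℕ) : ℝ≥0∞ :=
  ∫⁻ ω, (f ω : ℝ≥0∞) ∂P

end AgeOfInfo

namespace AgeOfInfo

/-! ### The shift on an infinite product space -/

section Shift

variable {ι E : Type*} [MeasurableSpace E]

/-! Once packet `0` has been served, the age at time `t` counts the slots `u < t` such that no
packet generated after `u` has been served (`unservedCount`). Summing over `t` and exchanging the
two counts (`sum_unservedCount`) charges to each slot `u` the time until some later-generated packet
is served. For `u` between the generations of packets `i` and `i + 1` this moment is `genTime x (i +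
1) + delay x s i`, whatever `u` is, so the block of `x i` slots costs `(x i).choose 2 + x i * delay
x s i`.

These costs are one functional evaluated along the shifts of the pair of sequences. The shift is
ergodic by Kolmogorov's zero-one law (`ergodic_comp_infinitePi`), so Birkhoff's theorem
(`ae_tendsto_nat_birkhoffSum_div`) gives their average, even when it is infinite. The age average is
the mean cost divided by the mean inter-generation time (`tendsto_average_age`). The delay after
packet `0` does not involve `X 0`, so the mean cost factors as `E[X.choose 2] + E[X] * E[minDelay]`
(`lintegral_mul_minDelay`); dividing by `E[X]` and using `2 * n.choose 2 = n ^ 2 - n` gives the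
formula and its `-1/2`. -/

lemma measurable_comp_iSup_compl (f : ι → ι) (F : Set ι) (hF : ∀ i, f i ∉ F) :
    Measurable[⨆ i ∈ Fᶜ, MeasurableSpace.comap (fun y : ι → E => y i) inferInstance]
      (fun y : ι → E => y ∘ f) := by
  refine @measurable_pi_lambda _ _ _ (_) _ _ fun i => ?_
  rw [measurable_iff_comap_le]
  exact le_iSup₂_of_le (f i) (hF i) le_rfl

/-- A reindexing of an infinite product of probability measures which preserves the factors, and
whose iterates leave every finite set of indices, is ergodic. -/
theorem ergodic_comp_infinitePi (P : ι → Measure E) [∀ i, IsProbabilityMeasure (P i)] {f : ι → ι}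
    (hf : Function.Injective f) (hP : ∀ i, P (f i) = P i)
    (hesc : ∀ F : Set ι, F.Finite → ∃ n, ∀ i, f^[n] i ∉ F) :
    Ergodic (fun y : ι → E => y ∘ f) (Measure.infinitePi P) := by
  have hmp : MeasurePreserving (fun y : ι → E => y ∘ f) (Measure.infinitePi P)
      (Measure.infinitePi P) := by
    refine ⟨measurable_pi_lambda _ fun i => measurable_pi_apply (f i), ?_⟩
    have := Measure.map_infinitePi_infinitePi_of_inj (P := P) hf
    simp only [hP] at this
    exact this
  refine ⟨hmp, ⟨fun A hA hinv => ?_⟩⟩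
  have hiter : ∀ n, (fun y : ι → E => y ∘ f^[n]) ⁻¹' A = A := by
    intro n
    induction n with
    | zero => rfl
    | succ n ih =>
      calc (fun y : ι → E => y ∘ f^[n + 1]) ⁻¹' A
          = (fun y : ι → E => y ∘ f^[n]) ⁻¹' ((fun y : ι → E => y ∘ f) ⁻¹' A) := by
            ext y
            simp only [Set.mem_preimage, Function.iterate_succ, Function.comp_assoc]
        _ = A := by rw [hinv, ih]
  have hindep : iIndep (fun i => MeasurableSpace.comap (fun y : ι → E => y i) inferInstance)
      (Measure.infinitePi P) :=
    iIndepFun_infinitePi (X := fun _ x => x) (fun _ => measurable_id)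
  -- An invariant set equals its preimage under `y ↦ y ∘ f^[n]`, a map that for suitable `n` reads
  -- no coordinate in `F`. As the finite set `F` is arbitrary, the set is a tail event.
  have htail : MeasurableSet[limsup
      (fun i => MeasurableSpace.comap (fun y : ι → E => y i) inferInstance) cofinite] A := by
    rw [hasBasis_cofinite.limsup_eq_iInf_iSup]
    refine MeasurableSpace.measurableSet_iInf.2 fun F => MeasurableSpace.measurableSet_iInf.2
      fun hF => ?_
    obtain ⟨n, hn⟩ := hesc F hF
    rw [← hiter n]
    exact measurable_comp_iSup_compl f^[n] F hn hA
  have h01 := measure_zero_or_one_of_measurableSet_limsup (p := Set.Finite)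
    (ns := fun F : Finset ι => (F : Set ι)) (fun i => (measurable_pi_apply i).comap_le) hindep
    (fun t ht => ht.compl_mem_cofinite) (fun F G => by
      classical
      exact ⟨F ∪ G, by simp, by simp⟩) (fun F => F.finite_toSet)
    (fun i => ⟨{i}, by simp⟩) htail
  rw [Filter.eventuallyConst_set']
  rcases h01 with h | h
  · exact Or.inl (ae_eq_empty.2 h)
  · exact Or.inr (eventuallyEq_univ.2 ((prob_compl_eq_zero_iff hA).2 h))

end Shift

/-! ### The pointwise ergodic theorem -/

section PointwiseErgodic

variable {α : Type*} {T : α → α}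

/-- The maximum of `0` and of the first `n` Birkhoff sums. -/
noncomputable def maxBirkhoffSum (T : α → α) (f : α → ℝ) : ℕ → α → ℝ
  | 0, _ => 0
  | n + 1, x => max 0 (f x + maxBirkhoffSum T f n (T x))

lemma maxBirkhoffSum_nonneg (f : α → ℝ) (n : ℕ) (x : α) : 0 ≤ maxBirkhoffSum T f n x := by
  cases n with
  | zero => exact le_rfl
  | succ n => exact le_max_left _ _

lemma maxBirkhoffSum_le_succ (f : α → ℝ) (n : ℕ) (x : α) :
    maxBirkhoffSum T f n x ≤ maxBirkhoffSum T f (n + 1) x := by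
  induction n generalizing x with
  | zero => exact le_max_left _ _
  | succ n ih => exact max_le_max le_rfl (by gcongr; exact ih _)

lemma birkhoffSum_le_maxBirkhoffSum (f : α → ℝ) (n : ℕ) (x : α) :
    birkhoffSum T f n x ≤ maxBirkhoffSum T f n x := by
  induction n generalizing x with
  | zero => simp [maxBirkhoffSum]
  | succ n ih =>
    rw [birkhoffSum_succ']
    exact le_max_of_le_right (by gcongr; exact ih _)

variable [MeasurableSpace α] {μ : Measure α}

lemma measurable_maxBirkhoffSum (hT : Measurable T) {f : α → ℝ} (hf : Measurable f) (n : ℕ) :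
    Measurable (maxBirkhoffSum T f n) := by
  induction n with
  | zero => exact measurable_const
  | succ n ih => exact measurable_const.max (hf.add (ih.comp hT))

lemma integrable_maxBirkhoffSum (hT : MeasurePreserving T μ μ) {f : α → ℝ}
    (hf : Integrable f μ) (n : ℕ) : Integrable (maxBirkhoffSum T f n) μ := by
  induction n with
  | zero => exact integrable_zero _ _ _
  | succ n ih =>
    exact (integrable_zero _ _ _).sup (hf.add (hT.integrable_comp_of_integrable ih))

/-- If the mean is negative, the Birkhoff sums of an ergodic map are bounded above almost
everywhere. -/
theorem ae_bddAbove_maxBirkhoffSum (hT : Ergodic T μ) {f : α → ℝ} (hfm : Measurable f)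
    (hf : Integrable f μ) (hneg : ∫ x, f x ∂μ < 0) :
    ∀ᵐ x ∂μ, ∃ C, ∀ n, maxBirkhoffSum T f n x ≤ C := by
  set A : Set α := {x | ∃ C : ℕ, ∀ n, maxBirkhoffSum T f n x ≤ C} with hA
  have hAm : MeasurableSet A := by
    have : A = ⋃ C : ℕ, ⋂ n, {x | maxBirkhoffSum T f n x ≤ C} := by ext; simp [hA]
    rw [this]
    exact MeasurableSet.iUnion fun C => MeasurableSet.iInter fun n =>
      measurableSet_le (measurable_maxBirkhoffSum hT.measurable hfm n) measurable_const
  have hinv : T ⁻¹' A = A := by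
    ext x
    simp only [hA, Set.mem_preimage, Set.mem_ofPred_eq]
    constructor
    · rintro ⟨C, hC⟩
      obtain ⟨C', hC'⟩ := exists_nat_ge (max 0 (f x + C))
      refine ⟨C', fun n => (maxBirkhoffSum_le_succ f n x).trans (le_trans ?_ hC')⟩
      exact max_le_max le_rfl (by gcongr; exact hC n)
    · rintro ⟨C, hC⟩
      obtain ⟨C', hC'⟩ := exists_nat_ge (C - f x)
      refine ⟨C', fun n => le_trans ?_ hC'⟩
      have := (le_max_right _ _).trans (hC (n + 1))
      linarith
  rcases hT.toPreErgodic.ae_mem_or_ae_notMem hAm hinv with h | h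
  · filter_upwards [h] with x ⟨C, hC⟩ using ⟨C, hC⟩
  exfalso
  -- The integrand is `max (-M_n (T x)) (f x)`, where `M_n ≥ 0` is the maximal sum. It is dominated
  -- by `|f|` and equals `f x` once `M_n (T x) ≥ -f x`, which happens eventually where the maximal
  -- sums are unbounded.
  have hlim : Tendsto (fun n => ∫ x, (maxBirkhoffSum T f (n + 1) x - maxBirkhoffSum T f n (T x)) ∂μ)
      atTop (nhds (∫ x, f x ∂μ)) := by
    refine tendsto_integral_of_dominated_convergence (fun x => |f x|) (fun n => ?_) hf.abs
      (fun n => ?_) ?_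
    · exact ((measurable_maxBirkhoffSum hT.measurable hfm _).sub
        ((measurable_maxBirkhoffSum hT.measurable hfm _).comp hT.measurable)).aestronglyMeasurable
    · refine Eventually.of_forall fun x => ?_
      have h0 := maxBirkhoffSum_nonneg (T := T) f n (T x)
      rw [Real.norm_eq_abs]
      simp only [maxBirkhoffSum]
      rcases max_cases 0 (f x + maxBirkhoffSum T f n (T x)) with ⟨h1, h2⟩ | ⟨h1, h2⟩ <;> rw [h1]
      · rw [abs_of_nonpos (by linarith), abs_of_nonpos (by linarith)]
        linarith
      · simp
    · filter_upwards [h] with x hx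
      have hmem : T x ∉ A := by rwa [← Set.mem_preimage, hinv]
      simp only [hA, Set.mem_ofPred_eq, not_exists, not_forall, not_le] at hmem
      obtain ⟨C, hC⟩ := exists_nat_ge (-f x)
      obtain ⟨N, hN⟩ := hmem C
      refine tendsto_const_nhds.congr' ?_
      filter_upwards [eventually_ge_atTop N] with n hn
      have hmono : maxBirkhoffSum T f N (T x) ≤ maxBirkhoffSum T f n (T x) :=
        monotone_nat_of_le_succ (f := fun n => maxBirkhoffSum T f n (T x))
          (fun n => maxBirkhoffSum_le_succ f n _) hn
      simp only [maxBirkhoffSum]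
      rw [max_eq_right (by linarith)]
      ring
  -- By invariance of `μ` each integral is that of `M_{n+1} - M_n ≥ 0`, so the limit cannot be
  -- negative.
  refine absurd (ge_of_tendsto' hlim fun n => ?_) (not_le.2 hneg)
  have hi := integrable_maxBirkhoffSum hT.toMeasurePreserving hf
  have hcomp : ∫ x, maxBirkhoffSum T f n (T x) ∂μ = ∫ x, maxBirkhoffSum T f n x ∂μ := by
    conv_rhs => rw [← hT.toMeasurePreserving.map_eq]
    exact (integral_map hT.measurable.aemeasurable
      (measurable_maxBirkhoffSum hT.measurable hfm n).aestronglyMeasurable).symm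
  have hiT : Integrable (fun x => maxBirkhoffSum T f n (T x)) μ :=
    hT.toMeasurePreserving.integrable_comp_of_integrable (hi n)
  rw [integral_sub (hi _) hiT, hcomp, sub_nonneg]
  exact integral_mono (hi _) (hi _) (maxBirkhoffSum_le_succ f n)

variable [IsProbabilityMeasure μ]

/-- The function `f - c` has negative mean, so its Birkhoff sums are bounded above. -/
lemma ae_exists_birkhoffSum_le (hT : Ergodic T μ) {f : α → ℝ} (hfm : Measurable f)
    (hf : Integrable f μ) {c : ℝ} (hc : ∫ x, f x ∂μ < c) :
    ∀ᵐ x ∂μ, ∃ C, ∀ n : ℕ, birkhoffSum T f n x ≤ n * c + C := by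
  have h := ae_bddAbove_maxBirkhoffSum hT (f := fun x => f x - c) (hfm.sub_const c)
    (hf.sub (integrable_const c)) (by
      rw [integral_sub hf (integrable_const c)]
      simpa using hc)
  filter_upwards [h] with x ⟨C, hC⟩
  refine ⟨C, fun n => ?_⟩
  have := (birkhoffSum_le_maxBirkhoffSum (T := T) (fun x => f x - c) n x).trans (hC n)
  simp only [birkhoffSum, Finset.sum_sub_distrib, Finset.sum_const, Finset.card_range,
    nsmul_eq_mul] at this ⊢
  linarith

lemma eventually_div_lt_of_le {u : ℕ → ℝ} {c c' C : ℝ} (h : ∀ n : ℕ, u n ≤ n * c + C)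
    (hc : c < c') : ∀ᶠ n : ℕ in atTop, u n / n < c' := by
  obtain ⟨N, hN⟩ := exists_nat_gt (C / (c' - c))
  filter_upwards [eventually_ge_atTop N, eventually_gt_atTop 0] with n hn hn0
  have hn0' : (0 : ℝ) < n := by exact_mod_cast hn0
  rw [div_lt_iff₀ hn0']
  have h1 : C / (c' - c) < n := hN.trans_le (by exact_mod_cast hn)
  rw [div_lt_iff₀ (by linarith)] at h1
  nlinarith [h n]

/-- Birkhoff's ergodic theorem for an ergodic map of a probability space. -/
theorem ae_tendsto_birkhoffSum_div (hT : Ergodic T μ) {f : α → ℝ} (hfm : Measurable f)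
    (hf : Integrable f μ) :
    ∀ᵐ x ∂μ, Tendsto (fun n : ℕ => birkhoffSum T f n x / n) atTop (nhds (∫ x, f x ∂μ)) := by
  set m := ∫ x, f x ∂μ with hm
  have hpos : ∀ k : ℕ, (0 : ℝ) < 1 / (k + 1) := fun k => by positivity
  have hup : ∀ᵐ x ∂μ, ∀ k : ℕ, ∃ C, ∀ n : ℕ, birkhoffSum T f n x ≤ n * (m + 1 / (k + 1)) + C :=
    ae_all_iff.2 fun k => ae_exists_birkhoffSum_le hT hfm hf (by linarith [hpos k])
  have hlo : ∀ᵐ x ∂μ, ∀ k : ℕ, ∃ C, ∀ n : ℕ,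
      birkhoffSum T (fun x => -f x) n x ≤ n * (-m + 1 / (k + 1)) + C :=
    ae_all_iff.2 fun k => ae_exists_birkhoffSum_le hT hfm.neg hf.neg (by
      simp only [Pi.neg_apply, integral_neg]
      linarith [hpos k])
  filter_upwards [hup, hlo] with x hu hl
  rw [tendsto_order]
  constructor
  · intro a ha
    obtain ⟨k, hk⟩ := exists_nat_one_div_lt (sub_pos.2 ha)
    obtain ⟨C, hC⟩ := hl k
    filter_upwards [eventually_div_lt_of_le hC (c' := -a) (by linarith)] with n hn
    simp only [birkhoffSum, Finset.sum_neg_distrib, neg_div] at hn ⊢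
    linarith
  · intro a ha
    obtain ⟨k, hk⟩ := exists_nat_one_div_lt (sub_pos.2 ha)
    obtain ⟨C, hC⟩ := hu k
    exact eventually_div_lt_of_le hC (by linarith)

lemma ae_tendsto_nat_birkhoffSum_div_of_ne_top (hT : Ergodic T μ) {f : α → ℕ} (hf : Measurable f)
    (hfin : ∫⁻ x, (f x : ℝ≥0∞) ∂μ ≠ ∞) :
    ∀ᵐ x ∂μ, Tendsto (fun n : ℕ => ((∑ i ∈ Finset.range n, f (T^[i] x) : ℕ) : ℝ≥0∞) / n) atTop
      (nhds (∫⁻ x, (f x : ℝ≥0∞) ∂μ)) := by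
  have hfm : Measurable fun x => (f x : ℝ) := measurable_from_top.comp hf
  have hofReal : ∀ x, ENNReal.ofReal (f x : ℝ) = (f x : ℝ≥0∞) := fun x => by simp
  have hint : Integrable (fun x => (f x : ℝ)) μ := by
    refine ⟨hfm.aestronglyMeasurable, ?_⟩
    rw [hasFiniteIntegral_iff_ofReal (Eventually.of_forall fun x => by positivity)]
    simpa only [hofReal] using hfin.lt_top
  filter_upwards [ae_tendsto_birkhoffSum_div hT hfm hint] with x hx
  have h := ENNReal.tendsto_ofReal hx
  rw [ofReal_integral_eq_lintegral_ofReal hint (Eventually.of_forall fun x => by positivity)] at h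
  simp only [hofReal] at h
  refine h.congr' ?_
  filter_upwards [eventually_gt_atTop 0] with n hn
  rw [ENNReal.ofReal_div_of_pos (by exact_mod_cast hn), ENNReal.ofReal_natCast, birkhoffSum,
    ← Nat.cast_sum, ENNReal.ofReal_natCast]

/-- Birkhoff's ergodic theorem for functions with values in the natural numbers, whose mean may be
infinite. -/
theorem ae_tendsto_nat_birkhoffSum_div (hT : Ergodic T μ) {f : α → ℕ} (hf : Measurable f) :
    ∀ᵐ x ∂μ, Tendsto (fun n : ℕ => ((∑ i ∈ Finset.range n, f (T^[i] x) : ℕ) : ℝ≥0∞) / n) atTop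
      (nhds (∫⁻ x, (f x : ℝ≥0∞) ∂μ)) := by
  rcases ne_or_eq (∫⁻ x, (f x : ℝ≥0∞) ∂μ) ∞ with hfin | hinf
  · exact ae_tendsto_nat_birkhoffSum_div_of_ne_top hT hf hfin
  -- With infinite mean, the truncations at `K` obey the finite-mean theorem, and their means
  -- increase to infinity by monotone convergence.
  have hK : ∀ᵐ x ∂μ, ∀ K : ℕ, Tendsto
      (fun n : ℕ => ((∑ i ∈ Finset.range n, min (f (T^[i] x)) K : ℕ) : ℝ≥0∞) / n) atTop
      (nhds (∫⁻ x, ((min (f x) K : ℕ) : ℝ≥0∞) ∂μ)) := by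
    refine ae_all_iff.2 fun K => ae_tendsto_nat_birkhoffSum_div_of_ne_top hT
      (f := fun x => min (f x) K) (hf.min measurable_const) (ne_top_of_le_ne_top ?_
        (lintegral_mono (g := fun _ => (K : ℝ≥0∞)) fun x => Nat.cast_le.2 (min_le_right _ _)))
    simp
  have hsup : ⨆ K : ℕ, ∫⁻ x, ((min (f x) K : ℕ) : ℝ≥0∞) ∂μ = ∞ := by
    have hmeas : ∀ K : ℕ, Measurable fun x => ((min (f x) K : ℕ) : ℝ≥0∞) := fun K =>
      measurable_from_top.comp (hf.min measurable_const)
    have hmono : Monotone fun (K : ℕ) x => ((min (f x) K : ℕ) : ℝ≥0∞) := fun K L hKL x =>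
      Nat.cast_le.2 (min_le_min le_rfl hKL)
    rw [← lintegral_iSup hmeas hmono, ← hinf]
    refine lintegral_congr fun x => le_antisymm (iSup_le fun K => by gcongr; exact min_le_left _ _)
      (le_iSup_of_le (f x) (by simp))
  filter_upwards [hK] with x hx
  rw [hinf, ENNReal.tendsto_nhds_top_iff_nnreal]
  intro a
  obtain ⟨K, hK⟩ := lt_iSup_iff.1 (hsup ▸ ENNReal.coe_lt_top : (a : ℝ≥0∞) < _)
  filter_upwards [(hx K).eventually_const_lt hK] with n hn
  refine hn.trans_le ?_
  gcongr
  exact min_le_left _ _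

end PointwiseErgodic

end AgeOfInfo

namespace AgeOfInfo

/-! ### The sum of the ages along a path -/

section Path

variable (x s : ℕ → ℕ)

lemma genTime_succ (i : ℕ) : genTime x (i + 1) = genTime x i + x i := Finset.sum_range_succ _ _

lemma genTime_add (i l : ℕ) :
    genTime x (i + 1 + l) = genTime x (i + 1) + ∑ k ∈ Finset.Icc 1 l, x (i + k) := by
  induction l with
  | zero => simp
  | succ l ih =>
    rw [← Nat.add_assoc, genTime_succ, ih, Finset.sum_Icc_succ_top (by omega)]
    grind

lemma genTime_mono : Monotone (genTime x) :=
  monotone_nat_of_le_succ fun i => by rw [genTime_succ]; omega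

variable {x} in
lemma genTime_strictMono (hx : ∀ k, 1 ≤ x k) : StrictMono (genTime x) :=
  strictMono_nat_of_lt_succ fun i => by rw [genTime_succ]; have := hx i; omega

/-- At the beginning of slot `t`, no packet generated after slot `u` has been served. -/
def Unserved (t u : ℕ) : Prop := ∀ j, u < genTime x j → t < genTime x j + s j

open Classical in
/-- The number of slots `u < t` such that, at the beginning of slot `t`, no packet generated after
slot `u` has been served. -/
noncomputable def unservedCount (t : ℕ) : ℕ :=
  ((Finset.range t).filter (Unserved x s t)).card

variable {x s}

lemma age_succ_le_iff (hs : ∀ k, 1 ≤ s k) (a₀ t k : ℕ) :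
    age x s a₀ (t + 1) ≤ k ↔ (age x s a₀ t + 1 ≤ k ∨
      ∃ i, genTime x i + s i = t + 1 ∧ t + 1 ≤ genTime x i + k) := by
  have hne : (insert (age x s a₀ t)
      {a | ∃ i, ServedAt x s i t ∧ a = t - genTime x i}).Nonempty := Set.insert_nonempty _ _
  constructor
  · intro h
    rcases Nat.sInf_mem hne with h' | ⟨i, hi, h'⟩
    · left
      simp only [age] at h
      omega
    · right
      refine ⟨i, hi, ?_⟩
      simp only [age] at h
      have := hs i
      simp only [ServedAt] at hi
      omega
  · rintro (h | ⟨i, hi, h⟩)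
    · exact (Nat.succ_le_succ (Nat.sInf_le (Set.mem_insert _ _))).trans h
    · have h1 : sInf (insert (age x s a₀ t)
          {a | ∃ i, ServedAt x s i t ∧ a = t - genTime x i}) ≤ t - genTime x i :=
        Nat.sInf_le (Set.mem_insert_of_mem _ ⟨i, hi, rfl⟩)
      have := hs i
      simp only [age]
      omega

/-- The age is the time since the generation of the freshest packet served. -/
lemma age_le_iff (hs : ∀ k, 1 ≤ s k) (a₀ t k : ℕ) :
    age x s a₀ t ≤ k ↔
      (a₀ + t ≤ k ∨ ∃ i, genTime x i + s i ≤ t ∧ t ≤ genTime x i + k) := by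
  induction t generalizing k with
  | zero =>
    refine ⟨Or.inl, fun h => h.resolve_right ?_⟩
    rintro ⟨i, hi, -⟩
    have := hs i
    omega
  | succ t ih =>
    rw [age_succ_le_iff hs]
    constructor
    · rintro (h | ⟨i, hi, h⟩)
      · rcases (ih (k - 1)).1 (by omega) with h' | ⟨i, hi, h'⟩
        · exact Or.inl (by omega)
        · exact Or.inr ⟨i, by omega, by omega⟩
      · exact Or.inr ⟨i, hi.le, h⟩
    · rintro (h | ⟨i, hi, h⟩)
      · have := (ih (k - 1)).2 (Or.inl (by omega))
        left
        omega
      · rcases hi.lt_or_eq with hi | hi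
        · have := hs i
          have := (ih (k - 1)).2 (Or.inr ⟨i, by omega, by omega⟩)
          left
          omega
        · exact Or.inr ⟨i, hi, h⟩

lemma unservedCount_le_self (t : ℕ) : unservedCount x s t ≤ t := by
  classical
  exact (Finset.card_filter_le _ _).trans (Finset.card_range t).le

/-- A slot before the generation of packet `i` is not counted, since packet `i` is a later packet
already served. -/
lemma unservedCount_le {t i : ℕ} (hi : genTime x i + s i ≤ t) :
    unservedCount x s t ≤ t - genTime x i := by
  classical
  calc unservedCount x s t ≤ (Finset.Ico (genTime x i) t).card := by
        refine Finset.card_le_card fun u hu => ?_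
        rw [Finset.mem_filter, Finset.mem_range] at hu
        rw [Finset.mem_Ico]
        refine ⟨?_, hu.1⟩
        by_contra! h
        have := hu.2 i h
        omega
    _ = t - genTime x i := by simp

lemma unservedCount_le_age (hs : ∀ k, 1 ≤ s k) (a₀ t : ℕ) :
    unservedCount x s t ≤ age x s a₀ t := by
  rcases (age_le_iff (x := x) hs a₀ t (age x s a₀ t)).1 le_rfl with h | ⟨i, hi, h⟩
  · exact (unservedCount_le_self t).trans (by omega)
  · exact (unservedCount_le hi).trans (by omega)

/-- Once packet `0` has been served, the age does not depend on its initial value. -/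
lemma age_le_unservedCount (hs : ∀ k, 1 ≤ s k) (a₀ : ℕ) {t : ℕ} (ht : s 0 ≤ t) :
    age x s a₀ t ≤ unservedCount x s t := by
  classical
  -- The largest element of `M` is the generation time of the freshest packet served; every slot
  -- from it up to `t` is counted.
  set M : Set ℕ := {z | ∃ j, genTime x j + s j ≤ t ∧ z = genTime x j} with hM
  have hne : M.Nonempty := ⟨0, 0, by simpa [genTime] using ht, by simp [genTime]⟩
  have hbdd : BddAbove M := ⟨t, by rintro z ⟨j, hj, rfl⟩; omega⟩
  obtain ⟨i, hi, hi'⟩ := Nat.sSup_mem hne hbdd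
  rw [age_le_iff hs]
  refine Or.inr ⟨i, hi, ?_⟩
  have hsub : Finset.Ico (genTime x i) t ⊆ (Finset.range t).filter (Unserved x s t) := by
    intro u hu
    rw [Finset.mem_Ico] at hu
    rw [Finset.mem_filter, Finset.mem_range]
    refine ⟨hu.2, fun j hj => ?_⟩
    by_contra! h
    have : genTime x j ≤ sSup M := le_csSup hbdd ⟨j, h, rfl⟩
    omega
  have := Finset.card_le_card hsub
  rw [Nat.card_Ico] at this
  change t - genTime x i ≤ unservedCount x s t at this
  omega

lemma age_le_add (hs : ∀ k, 1 ≤ s k) (a₀ t : ℕ) : age x s a₀ t ≤ a₀ + t :=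
  (age_le_iff hs a₀ t _).2 (Or.inl le_rfl)

/-- The initial age matters only in slots before `s 0`; their contribution is bounded independently
of `T` and vanishes in the average. -/
lemma sum_age_le (hs : ∀ k, 1 ≤ s k) (a₀ T : ℕ) :
    ∑ t ∈ Finset.Icc 1 T, age x s a₀ t ≤
      ∑ t ∈ Finset.range (s 0), (a₀ + t) + ∑ t ∈ Finset.Icc 1 T, unservedCount x s t := by
  classical
  calc ∑ t ∈ Finset.Icc 1 T, age x s a₀ t
      ≤ ∑ t ∈ Finset.Icc 1 T, ((if t ∈ Finset.range (s 0) then a₀ + t else 0)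
          + unservedCount x s t) := by
        refine Finset.sum_le_sum fun t _ => ?_
        split_ifs with h
        · exact (age_le_add hs a₀ t).trans (Nat.le_add_right _ _)
        · rw [Nat.zero_add]
          exact age_le_unservedCount hs a₀ (by simpa using h)
    _ ≤ _ := by
        rw [Finset.sum_add_distrib, ← Finset.sum_filter]
        gcongr
        intro t ht
        exact (Finset.mem_filter.1 ht).2

/-- The delay, measured from the generation of packet `i + 1`, after which packet `i + 1` or a
later packet is served. -/
noncomputable def delay (x s : ℕ → ℕ) (i : ℕ) : ℕ :=
  minDelay (fun k => x (i + k)) (fun k => s (i + k))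

lemma lt_of_lt_delay {i t j : ℕ} (ht : t < genTime x (i + 1) + delay x s i) (hj : i + 1 ≤ j) :
    t < genTime x j + s j := by
  obtain ⟨l, rfl⟩ := Nat.exists_eq_add_of_le hj
  have : delay x s i ≤ ∑ k ∈ Finset.Icc 1 l, x (i + k) + s (i + (l + 1)) :=
    Nat.sInf_le ⟨l, rfl⟩
  rw [genTime_add]
  have e : i + (l + 1) = i + 1 + l := by omega
  rw [e] at this
  omega

lemma exists_eq_delay (x s : ℕ → ℕ) (i : ℕ) :
    ∃ j, i + 1 ≤ j ∧ genTime x j + s j = genTime x (i + 1) + delay x s i := by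
  obtain ⟨l, hl⟩ := Nat.sInf_mem (Set.range_nonempty fun l : ℕ =>
    ∑ k ∈ Finset.Icc 1 l, x (i + k) + s (i + (l + 1)))
  refine ⟨i + 1 + l, by omega, ?_⟩
  have e : i + (l + 1) = i + 1 + l := by omega
  simp only [e] at hl
  rw [genTime_add, Nat.add_assoc, hl]
  simp only [delay, minDelay]

/-- The packets generated after such a slot `u` are exactly those of index at least `i + 1`, and
`delay` is the attained minimum of their completion times relative to `genTime x (i + 1)`. -/
lemma unserved_iff {i t u : ℕ} (hi : genTime x i ≤ u) (hu : u < genTime x (i + 1)) :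
    Unserved x s t u ↔ t < genTime x (i + 1) + delay x s i := by
  constructor
  · intro h
    obtain ⟨j, hj, hj'⟩ := exists_eq_delay x s i
    rw [← hj']
    exact h j (hu.trans_le (genTime_mono x hj))
  · intro h j hj
    refine lt_of_lt_delay h ?_
    by_contra! hlt
    have := genTime_mono x (Nat.lt_succ_iff.1 hlt)
    omega

open Classical in
/-- The number of slots `t` among `u + 1, …, T` at whose beginning no packet generated after
slot `u` has been served. -/
noncomputable def waitCount (x s : ℕ → ℕ) (T u : ℕ) : ℕ :=
  ((Finset.Icc 1 T).filter fun t => u < t ∧ Unserved x s t u).card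

/-- Double counting of the pairs `u < t`. -/
lemma sum_unservedCount (x s : ℕ → ℕ) (T : ℕ) :
    ∑ t ∈ Finset.Icc 1 T, unservedCount x s t = ∑ u ∈ Finset.range T, waitCount x s T u := by
  classical
  have h1 : ∀ t ∈ Finset.Icc 1 T, unservedCount x s t =
      ((Finset.range T).filter fun u => u < t ∧ Unserved x s t u).card := by
    intro t ht
    rw [Finset.mem_Icc] at ht
    refine congrArg Finset.card (Finset.ext fun u => ?_)
    simp only [Finset.mem_filter, Finset.mem_range]
    constructor
    · rintro ⟨h, h'⟩
      exact ⟨by omega, h, h'⟩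
    · rintro ⟨_, h, h'⟩
      exact ⟨h, h'⟩
  rw [Finset.sum_congr rfl h1]
  exact Finset.sum_card_bipartiteAbove_eq_sum_card_bipartiteBelow
    (r := fun t u => u < t ∧ Unserved x s t u)

lemma waitCount_le {i u : ℕ} (hi : genTime x i ≤ u) (hu : u < genTime x (i + 1)) (T : ℕ) :
    waitCount x s T u ≤ genTime x (i + 1) + delay x s i - u - 1 := by
  classical
  rw [← Nat.card_Ioo]
  refine Finset.card_le_card fun t ht => ?_
  rw [Finset.mem_filter, unserved_iff hi hu] at ht
  exact Finset.mem_Ioo.2 ht.2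

/-- The wait may run past the horizon `T`; capping the delay at `K` keeps the counted slots at or
before `T`. -/
lemma le_waitCount {i u K T : ℕ} (hi : genTime x i ≤ u) (hu : u < genTime x (i + 1))
    (hT : genTime x (i + 1) + K ≤ T) :
    genTime x (i + 1) + min (delay x s i) K - u - 1 ≤ waitCount x s T u := by
  classical
  rw [← Nat.card_Ioo]
  refine Finset.card_le_card fun t ht => ?_
  rw [Finset.mem_Ioo] at ht
  rw [Finset.mem_filter, unserved_iff hi hu, Finset.mem_Icc]
  omega

lemma sum_Ico_sub (a n d : ℕ) :
    ∑ u ∈ Finset.Ico a (a + n), (a + n + d - u - 1) = n.choose 2 + n * d := by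
  rw [Finset.sum_Ico_eq_sum_range, Nat.add_sub_cancel_left, ← Finset.sum_range_reflect]
  calc ∑ j ∈ Finset.range n, (a + n + d - (a + (n - 1 - j)) - 1)
      = ∑ j ∈ Finset.range n, (j + d) := by
        refine Finset.sum_congr rfl fun j hj => ?_
        rw [Finset.mem_range] at hj
        omega
    _ = _ := by
        rw [Finset.sum_add_distrib, Finset.sum_range_id, Nat.choose_two_right]
        simp

lemma sum_range_genTime (x : ℕ → ℕ) (g : ℕ → ℕ) (n : ℕ) :
    ∑ u ∈ Finset.range (genTime x n), g u =
      ∑ i ∈ Finset.range n, ∑ u ∈ Finset.Ico (genTime x i) (genTime x (i + 1)), g u := by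
  induction n with
  | zero => simp [genTime]
  | succ n ih =>
    rw [Finset.sum_range_succ, ← ih, Finset.sum_range_add_sum_Ico _ (genTime_mono x n.le_succ)]

lemma sum_unservedCount_le {n T : ℕ} (hT : T ≤ genTime x n) :
    ∑ t ∈ Finset.Icc 1 T, unservedCount x s t ≤
      ∑ i ∈ Finset.range n, ((x i).choose 2 + x i * delay x s i) := by
  rw [sum_unservedCount]
  calc ∑ u ∈ Finset.range T, waitCount x s T u
      ≤ ∑ u ∈ Finset.range (genTime x n), waitCount x s T u :=
        Finset.sum_le_sum_of_subset (Finset.range_mono hT)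
    _ ≤ _ := by
        rw [sum_range_genTime]
        refine Finset.sum_le_sum fun i _ => ?_
        rw [← sum_Ico_sub (genTime x i), ← genTime_succ]
        refine Finset.sum_le_sum fun u hu => ?_
        rw [Finset.mem_Ico] at hu
        exact waitCount_le hu.1 hu.2 T

lemma le_sum_unservedCount {n K T : ℕ} (hT : genTime x n + K ≤ T) :
    ∑ i ∈ Finset.range n, ((x i).choose 2 + x i * min (delay x s i) K) ≤
      ∑ t ∈ Finset.Icc 1 T, unservedCount x s t := by
  rw [sum_unservedCount]
  calc _ ≤ ∑ u ∈ Finset.range (genTime x n), waitCount x s T u := by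
        rw [sum_range_genTime]
        refine Finset.sum_le_sum fun i hi => ?_
        rw [← sum_Ico_sub (genTime x i), ← genTime_succ]
        refine Finset.sum_le_sum fun u hu => ?_
        rw [Finset.mem_Ico] at hu
        have : genTime x (i + 1) ≤ genTime x n := genTime_mono x (Finset.mem_range.1 hi)
        exact le_waitCount hu.1 hu.2 (by omega)
    _ ≤ _ := Finset.sum_le_sum_of_subset (Finset.range_mono (by omega))

/-! ### Time averages from averages over packets -/

lemma exists_genTime_le_lt (hx : ∀ k, 1 ≤ x k) :
    ∃ N : ℕ → ℕ, Tendsto N atTop atTop ∧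
      ∀ T, genTime x (N T) ≤ T ∧ T < genTime x (N T + 1) := by
  have hex : ∀ T, ∃ n, genTime x n ≤ T ∧ T < genTime x (n + 1) := by
    intro T
    induction T with
    | zero => exact ⟨0, by simp [genTime], by simpa [genTime] using Nat.pos_of_ne_zero (Nat.one_le_iff_ne_zero.1 (hx 0))⟩
    | succ T ih =>
      obtain ⟨n, h1, h2⟩ := ih
      rcases Nat.lt_or_ge (T + 1) (genTime x (n + 1)) with h | h
      · exact ⟨n, by omega, h⟩
      · refine ⟨n + 1, h, ?_⟩
        have : genTime x (n + 1) < genTime x (n + 1 + 1) :=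
          genTime_strictMono hx (Nat.lt_succ_self (n + 1))
        omega
  choose N hN using hex
  refine ⟨N, tendsto_atTop.2 fun b => ?_, hN⟩
  filter_upwards [eventually_ge_atTop (genTime x b)] with T hT
  by_contra! h
  have h1 := genTime_mono x h
  have h2 := (hN T).2
  simp only [Nat.succ_eq_add_one] at h1
  omega

/-- Costs and generation times are compared at indices `n` and `n + 1`; this brings both to the
denominator `n + 1`. -/
lemma tendsto_div_succ {u : ℕ → ℝ≥0∞} {L : ℝ≥0∞}
    (hu : Tendsto (fun n : ℕ => u n / n) atTop (nhds L)) :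
    Tendsto (fun n : ℕ => u n / (n + 1 : ℕ)) atTop (nhds L) := by
  have h1 : Tendsto (fun n : ℕ => ((n : ℝ≥0∞) / (n + 1 : ℕ))) atTop (nhds 1) := by
    have := ENNReal.tendsto_ofReal (tendsto_natCast_div_add_atTop (1 : ℝ))
    rw [ENNReal.ofReal_one] at this
    refine this.congr fun n => ?_
    rw [ENNReal.ofReal_div_of_pos (by positivity), ENNReal.ofReal_natCast]
    norm_cast
  have h2 := ENNReal.Tendsto.mul hu (Or.inr ENNReal.one_ne_top) h1 (Or.inl one_ne_zero)
  rw [mul_one] at h2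
  refine h2.congr' ?_
  filter_upwards [eventually_gt_atTop 0] with n hn
  rw [div_eq_mul_inv, div_eq_mul_inv, div_eq_mul_inv, mul_assoc, ← mul_assoc (n : ℝ≥0∞)⁻¹,
    ENNReal.inv_mul_cancel (by exact_mod_cast hn.ne') (ENNReal.natCast_ne_top n), one_mul]

lemma div_div_natCast (a b : ℝ≥0∞) (n : ℕ) :
    a / ((n + 1 : ℕ) : ℝ≥0∞) / (b / ((n + 1 : ℕ) : ℝ≥0∞)) = a / b := by
  have h0 : ((n + 1 : ℕ) : ℝ≥0∞) ≠ 0 := by exact_mod_cast n.succ_ne_zero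
  rw [div_eq_mul_inv a, div_eq_mul_inv b]
  exact ENNReal.mul_div_mul_right _ _ (ENNReal.inv_ne_zero.2 (ENNReal.natCast_ne_top _))
    (ENNReal.inv_ne_top.2 h0)

/-- The time average of the age is the average cost per packet, divided by the average time
between packets. -/
theorem tendsto_average_age (hx : ∀ k, 1 ≤ x k) (hs : ∀ k, 1 ≤ s k) (a₀ : ℕ) {m c : ℝ≥0∞}
    {cK : ℕ → ℝ≥0∞} (hm0 : m ≠ 0) (hmtop : m ≠ ∞)
    (hm : Tendsto (fun n : ℕ => ((∑ i ∈ Finset.range n, x i : ℕ) : ℝ≥0∞) / n) atTop (nhds m))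
    (hc : Tendsto (fun n : ℕ => ((∑ i ∈ Finset.range n,
      ((x i).choose 2 + x i * delay x s i) : ℕ) : ℝ≥0∞) / n) atTop (nhds c))
    (hcK : ∀ K, Tendsto (fun n : ℕ => ((∑ i ∈ Finset.range n,
      ((x i).choose 2 + x i * min (delay x s i) K) : ℕ) : ℝ≥0∞) / n) atTop (nhds (cK K)))
    (hsup : ⨆ K, cK K = c) :
    Tendsto (fun T : ℕ => ((∑ t ∈ Finset.Icc 1 T, age x s a₀ t : ℕ) : ℝ≥0∞) / T) atTop
      (nhds (c / m)) := by
  obtain ⟨N, hN, hN'⟩ := exists_genTime_le_lt hx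
  have hm' : Tendsto (fun n : ℕ => (genTime x n : ℝ≥0∞) / n) atTop (nhds m) := hm
  refine tendsto_of_le_liminf_of_limsup_le ?_ ?_
  · rw [← hsup, ENNReal.iSup_div]
    refine iSup_le fun K => ?_
    have hK0 : Tendsto (fun n : ℕ => (K : ℝ≥0∞) / (n + 1 : ℕ)) atTop (nhds 0) :=
      tendsto_div_succ (u := fun _ => (K : ℝ≥0∞)) (by
        simpa [div_eq_mul_inv] using ENNReal.Tendsto.const_mul ENNReal.tendsto_inv_nat_nhds_zero
          (Or.inr (ENNReal.natCast_ne_top K)))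
    have hden : Tendsto (fun n : ℕ => ((genTime x (n + 1) + K : ℕ) : ℝ≥0∞) / (n + 1 : ℕ)) atTop
        (nhds m) := by
      have := (hm'.comp (tendsto_add_atTop_nat 1)).add hK0
      rw [add_zero] at this
      refine this.congr fun n => ?_
      rw [Function.comp_apply, ← ENNReal.add_div, ← Nat.cast_add]
    have h := ENNReal.Tendsto.div (tendsto_div_succ (hcK K)) (Or.inr hm0) hden (Or.inl hmtop)
    simp only [div_div_natCast] at h
    -- With `n = N (T - K)`, `genTime x n + K ≤ T < genTime x (n + 1) + K`: the first bound is what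
    -- `le_sum_unservedCount` needs, the second controls the denominator.
    have hsub : Tendsto (fun T => N (T - K)) atTop atTop := hN.comp (tendsto_sub_atTop_nat K)
    rw [← (h.comp hsub).liminf_eq]
    refine liminf_le_liminf ?_
    filter_upwards [eventually_ge_atTop K] with T hT
    have h1 := hN' (T - K)
    refine ENNReal.div_le_div (Nat.cast_le.2 ?_) (Nat.cast_le.2 (by simp only; omega))
    exact (le_sum_unservedCount (by simp only; omega)).trans
      (Finset.sum_le_sum fun t _ => unservedCount_le_age hs a₀ t)
  · set C : ℕ := ∑ t ∈ Finset.range (s 0), (a₀ + t)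
    have hC0 : Tendsto (fun T : ℕ => (C : ℝ≥0∞) / T) atTop (nhds 0) := by
      simpa [div_eq_mul_inv] using ENNReal.Tendsto.const_mul ENNReal.tendsto_inv_nat_nhds_zero
          (Or.inr (ENNReal.natCast_ne_top C))
    have h := ENNReal.Tendsto.div (hc.comp (tendsto_add_atTop_nat 1)) (Or.inr hm0)
      (tendsto_div_succ hm') (Or.inl hmtop)
    simp only [Function.comp_apply, div_div_natCast] at h
    have h' := hC0.add (h.comp hN)
    rw [zero_add] at h'
    rw [← h'.limsup_eq]
    refine limsup_le_limsup (Eventually.of_forall fun T => ?_)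
    have h1 := hN' T
    calc ((∑ t ∈ Finset.Icc 1 T, age x s a₀ t : ℕ) : ℝ≥0∞) / T
        ≤ ((C + ∑ i ∈ Finset.range (N T + 1), ((x i).choose 2 + x i * delay x s i) : ℕ) : ℝ≥0∞)
            / T := by
          gcongr
          exact (sum_age_le hs a₀ T).trans (by gcongr; exact sum_unservedCount_le h1.2.le)
      _ = (C : ℝ≥0∞) / T + ((∑ i ∈ Finset.range (N T + 1),
            ((x i).choose 2 + x i * delay x s i) : ℕ) : ℝ≥0∞) / T := by
          rw [Nat.cast_add, ENNReal.add_div]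
      _ ≤ _ := by
          simp only [Function.comp_apply]
          gcongr
          exact h1.1

lemma averageAge_eq {A : ℕ → ℕ} {L : ℝ≥0∞}
    (h : Tendsto (fun T : ℕ => ((∑ t ∈ Finset.Icc 1 T, A t : ℕ) : ℝ≥0∞) / T) atTop (nhds L)) :
    averageAge A = (L : EReal) := by
  have h' := (continuous_coe_ennreal_ereal.tendsto L).comp h
  refine (h'.congr' ?_).limsup_eq
  filter_upwards [eventually_gt_atTop 0] with T hT
  have hT' : (0 : ℝ) < T := by exact_mod_cast hT
  have : ((∑ t ∈ Finset.Icc 1 T, A t : ℕ) : ℝ≥0∞) / T =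
      ENNReal.ofReal (1 / (T : ℝ) * ∑ t ∈ Finset.Icc 1 T, (A t : ℝ)) := by
    rw [one_div, mul_comm, ← div_eq_mul_inv, ENNReal.ofReal_div_of_pos hT', ENNReal.ofReal_natCast,
      ← Nat.cast_sum, ENNReal.ofReal_natCast]
  rw [Function.comp_apply, this, EReal.coe_ennreal_ofReal, max_eq_left (by positivity)]

end Path

end AgeOfInfo

namespace AgeOfInfo

/-! ### Independent and identically distributed sequences -/

section Law

variable {Ω : Type*} [MeasurableSpace Ω] {P : Measure Ω} {X S : ℕ → Ω → ℕ}

lemma measurable_natCast_ennreal {β : Type*} [MeasurableSpace β] {f : β → ℕ}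
    (hf : Measurable f) : Measurable fun b => (f b : ℝ≥0∞) :=
  measurable_from_top.comp hf

lemma sum_map_succ_iterate (n : ℕ) (j : ℕ ⊕ ℕ) :
    (Sum.map Nat.succ Nat.succ)^[n] j = Sum.map (fun k => n + k) (fun k => n + k) j := by
  induction n with
  | zero => cases j <;> simp
  | succ n ih =>
    rw [Function.iterate_succ_apply', ih]
    cases j <;> simp [Nat.succ_eq_add_one] <;> omega

lemma comp_iterate_apply {ι E : Type*} (f : ι → ι) (n : ℕ) (y : ι → E) :
    (fun y : ι → E => y ∘ f)^[n] y = y ∘ f^[n] := by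
  induction n generalizing y with
  | zero => rfl
  | succ n ih => rw [Function.iterate_succ_apply, ih, Function.comp_assoc, Function.iterate_succ']

lemma ergodic_shift (Q : ℕ ⊕ ℕ → Measure ℕ) [∀ j, IsProbabilityMeasure (Q j)]
    (hQ : ∀ j, Q (Sum.map Nat.succ Nat.succ j) = Q j) :
    Ergodic (fun y : ℕ ⊕ ℕ → ℕ => y ∘ Sum.map Nat.succ Nat.succ) (Measure.infinitePi Q) := by
  refine ergodic_comp_infinitePi Q (Nat.succ_injective.sumMap Nat.succ_injective) hQ
    fun F hF => ?_
  -- `N` bounds the indices in `F` from both sequences, so `N + 1` shifts leave `F`.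
  obtain ⟨N, hN⟩ := (hF.image (Sum.elim id id)).bddAbove
  refine ⟨N + 1, fun j hj => ?_⟩
  have := hN (Set.mem_image_of_mem _ hj)
  rw [sum_map_succ_iterate] at this
  cases j <;> simp at this <;> omega

/-- The law of large numbers for a functional of the shifted sequences. -/
lemma ae_tendsto_shift_average [IsProbabilityMeasure P]
    (hXmeas : ∀ k, Measurable (X k)) (hSmeas : ∀ k, Measurable (S k))
    (hXident : ∀ k, IdentDistrib (X k) (X 0) P P)
    (hSident : ∀ k, IdentDistrib (S k) (S 0) P P)
    (hindep : iIndepFun (fun j : ℕ ⊕ ℕ => (Sum.elim X S j : Ω → ℕ)) P)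
    {G : (ℕ → ℕ) → (ℕ → ℕ) → ℕ}
    (hG : Measurable fun y : ℕ ⊕ ℕ → ℕ => G (fun k => y (Sum.inl k)) (fun k => y (Sum.inr k))) :
    ∀ᵐ ω ∂P, Tendsto (fun n : ℕ => ((∑ i ∈ Finset.range n,
        G (fun k => X (i + k) ω) (fun k => S (i + k) ω) : ℕ) : ℝ≥0∞) / n) atTop
      (nhds (∫⁻ ω, (G (fun k => X k ω) (fun k => S k ω) : ℝ≥0∞) ∂P)) := by
  have hmeas : ∀ j, Measurable (Sum.elim X S j : Ω → ℕ) := Sum.rec hXmeas hSmeas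
  have hW : Measurable fun ω j => (Sum.elim X S j : Ω → ℕ) ω := measurable_pi_lambda _ hmeas
  have hprob : ∀ j, IsProbabilityMeasure (P.map (Sum.elim X S j : Ω → ℕ)) := fun j =>
    Measure.isProbabilityMeasure_map (hmeas j).aemeasurable
  have hmap := hindep.map_fun_eq_infinitePi_map hmeas
  have herg : Ergodic (fun y : ℕ ⊕ ℕ → ℕ => y ∘ Sum.map Nat.succ Nat.succ)
      (P.map fun ω j => (Sum.elim X S j : Ω → ℕ) ω) := by
    rw [hmap]
    refine ergodic_shift _ ?_
    rintro (k | k)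
    · exact ((hXident (k + 1)).trans (hXident k).symm).map_eq
    · exact ((hSident (k + 1)).trans (hSident k).symm).map_eq
  have : IsProbabilityMeasure (P.map fun ω j => (Sum.elim X S j : Ω → ℕ) ω) :=
    Measure.isProbabilityMeasure_map hW.aemeasurable
  have h := ae_of_ae_map hW.aemeasurable (ae_tendsto_nat_birkhoffSum_div herg hG)
  rw [lintegral_map (measurable_natCast_ennreal hG) hW] at h
  filter_upwards [h] with ω hω
  simp only [comp_iterate_apply, Function.comp_apply, sum_map_succ_iterate, Sum.map_inl,
    Sum.map_inr, Sum.elim_inl, Sum.elim_inr] at hω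
  exact hω

lemma minDelay_le_iff (x s : ℕ → ℕ) (n : ℕ) :
    minDelay x s ≤ n ↔ ∃ l, ∑ k ∈ Finset.Icc 1 l, x k + s (l + 1) ≤ n := by
  constructor
  · intro h
    obtain ⟨l, hl⟩ := Nat.sInf_mem (Set.range_nonempty fun l : ℕ =>
      ∑ k ∈ Finset.Icc 1 l, x k + s (l + 1))
    exact ⟨l, hl.trans_le h⟩
  · rintro ⟨l, hl⟩
    exact (Nat.sInf_le ⟨l, rfl⟩ : minDelay x s ≤ _).trans hl

/-- Measurability is asked only for indices `k ≥ 1`, so that the lemma also applies to the σ-algebra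
generated without `X 0`. -/
lemma measurable_minDelay {β : Type*} [MeasurableSpace β] {x s : β → ℕ → ℕ}
    (hx : ∀ k, 1 ≤ k → Measurable fun b => x b k) (hs : ∀ k, 1 ≤ k → Measurable fun b => s b k) :
    Measurable fun b => minDelay (x b) (s b) := by
  refine measurable_of_Iic fun n => ?_
  have : (fun b => minDelay (x b) (s b)) ⁻¹' Set.Iic n =
      ⋃ l : ℕ, {b | ∑ k ∈ Finset.Icc 1 l, x b k + s b (l + 1) ≤ n} := by
    ext b
    simp [minDelay_le_iff]
  rw [this]
  refine MeasurableSet.iUnion fun l => measurableSet_le (Measurable.add ?_ (hs _ (by omega)))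
    measurable_const
  exact Finset.measurable_fun_sum _ fun k hk => hx k (Finset.mem_Icc.1 hk).1

/-- The minimum reads only `X k` and `S k` with `k ≥ 1`, hence is measurable for the coordinates
other than `X 0` and independent of it. Both integrals may be infinite. -/
lemma lintegral_mul_minDelay
    (hXmeas : ∀ k, Measurable (X k)) (hSmeas : ∀ k, Measurable (S k))
    (hindep : iIndepFun (fun j : ℕ ⊕ ℕ => (Sum.elim X S j : Ω → ℕ)) P) :
    ∫⁻ ω, (X 0 ω : ℝ≥0∞) * (minDelay (fun k => X k ω) (fun k => S k ω) : ℝ≥0∞) ∂P =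
      (∫⁻ ω, (X 0 ω : ℝ≥0∞) ∂P) *
        ∫⁻ ω, (minDelay (fun k => X k ω) (fun k => S k ω) : ℝ≥0∞) ∂P := by
  set σ : ℕ ⊕ ℕ → MeasurableSpace Ω := fun j =>
    MeasurableSpace.comap (Sum.elim X S j : Ω → ℕ) inferInstance with hσ
  have hmeas : ∀ j, Measurable (Sum.elim X S j : Ω → ℕ) := Sum.rec hXmeas hSmeas
  have hle : ∀ j, σ j ≤ ‹MeasurableSpace Ω› := fun j => (hmeas j).comap_le
  have hcoord : ∀ {A : Set (ℕ ⊕ ℕ)} {j}, j ∈ A →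
      Measurable[⨆ i ∈ A, σ i] (Sum.elim X S j : Ω → ℕ) := fun {A j} hj =>
    measurable_iff_comap_le.2 (le_iSup₂_of_le j hj le_rfl)
  have hind : Indep (⨆ i ∈ ({Sum.inl 0} : Set (ℕ ⊕ ℕ)), σ i)
      (⨆ i ∈ ({Sum.inl 0} : Set (ℕ ⊕ ℕ))ᶜ, σ i) P :=
    indep_iSup_of_disjoint hle hindep disjoint_compl_right
  refine lintegral_mul_eq_lintegral_mul_lintegral_of_independent_measurableSpace
    (iSup₂_le fun i _ => hle i) (iSup₂_le fun i _ => hle i) hind ?_ ?_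
  · exact measurable_from_top.comp (hcoord (j := Sum.inl 0) rfl)
  · refine measurable_from_top.comp ?_
    refine @measurable_minDelay Ω (⨆ i ∈ ({Sum.inl 0} : Set (ℕ ⊕ ℕ))ᶜ, σ i)
      (fun ω k => X k ω) (fun ω k => S k ω) (fun k hk => ?_) (fun k _ => ?_)
    · exact hcoord (j := Sum.inl k) (by simp; omega)
    · exact hcoord (j := Sum.inr k) (by simp)

lemma two_mul_choose_two_add_self (n : ℕ) : 2 * n.choose 2 + n = n ^ 2 := by
  induction n with
  | zero => rfl
  | succ n ih =>
    have h : (n + 1).choose 2 = n + n.choose 2 := by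
      rw [Nat.choose_succ_succ' n 1, Nat.choose_one_right]
    rw [h]
    nlinarith

lemma expect_sq {f : Ω → ℕ} (hf : Measurable f) :
    expect P (fun ω => f ω ^ 2) = 2 * ∫⁻ ω, ((f ω).choose 2 : ℝ≥0∞) ∂P + expect P f := by
  have h1 : Measurable fun ω => ((f ω).choose 2 : ℝ≥0∞) :=
    measurable_natCast_ennreal
      ((measurable_from_top (f := fun n : ℕ => n.choose 2)).comp hf)
  rw [expect, expect, ← lintegral_const_mul _ h1, ← lintegral_add_left (h1.const_mul 2)]
  refine lintegral_congr fun ω => ?_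
  rw [← two_mul_choose_two_add_self]
  push_cast
  rfl

lemma coe_half_eq : ((1 / 2 : ℝ≥0∞) : EReal) = ((1 / 2 : ℝ) : EReal) := by
  have : (1 / 2 : ℝ≥0∞) = ENNReal.ofReal (1 / 2) := by
    rw [ENNReal.ofReal_div_of_pos (by norm_num)]
    simp
  rw [this, EReal.coe_ennreal_ofReal, max_eq_left (by norm_num)]

/-- Here `2 * C + m` is the second moment, and the extra `m / (2 * m)` is the subtracted `1/2`. The
cancellation is valid in `EReal`, even if `C` or `D` is infinite, because `1/2` is finite. -/
lemma coe_add_sub_half {m C D : ℝ≥0∞} (hm0 : m ≠ 0) (hmtop : m ≠ ∞) :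
    (((C + m * D) / m : ℝ≥0∞) : EReal) =
      (((2 * C + m) / (2 * m) : ℝ≥0∞) : EReal) + (D : EReal) - ((1 / 2 : ℝ) : EReal) := by
  have h1 : (2 * C + m) / (2 * m) = C / m + 1 / 2 := by
    rw [ENNReal.add_div, ENNReal.mul_div_mul_left _ _ two_ne_zero ENNReal.ofNat_ne_top]
    congr 1
    conv_lhs => rw [← one_mul m, ← mul_assoc, mul_one]
    exact ENNReal.mul_div_mul_right _ _ hm0 hmtop
  have h2 : (C + m * D) / m = C / m + D := by
    rw [ENNReal.add_div, mul_comm m D, ENNReal.mul_div_cancel_right hm0 hmtop]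
  rw [h1, h2, EReal.coe_ennreal_add, EReal.coe_ennreal_add, coe_half_eq, add_right_comm,
    EReal.add_sub_cancel_right]

end Law

end AgeOfInfo

theorem theorem4 {Ω : Type*} [MeasurableSpace Ω] (P : Measure Ω) [IsProbabilityMeasure P]
    (X S : ℕ → Ω → ℕ)
    (hXmeas : ∀ k, Measurable (X k)) (hSmeas : ∀ k, Measurable (S k))
    (hXident : ∀ k, IdentDistrib (X k) (X 0) P P)
    (hSident : ∀ k, IdentDistrib (S k) (S 0) P P)
    (hindep : iIndepFun (fun j : ℕ ⊕ ℕ => (Sum.elim X S j : Ω → ℕ)) P)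
    (hXpos : ∀ᵐ ω ∂P, 1 ≤ X 0 ω) (hSpos : ∀ᵐ ω ∂P, 1 ≤ S 0 ω)
    (hXmean : AgeOfInfo.expect P (X 0) ≠ ∞)
    (a₀ : ℕ) :
    ∀ᵐ ω ∂P,
      AgeOfInfo.averageAge (AgeOfInfo.age (fun k => X k ω) (fun k => S k ω) a₀) =
        ((AgeOfInfo.expect P (fun ω' => X 0 ω' ^ 2) / (2 * AgeOfInfo.expect P (X 0)) : ℝ≥0∞) :
            EReal)
          + ((AgeOfInfo.expect P
              (fun ω' => AgeOfInfo.minDelay (fun k => X k ω') (fun k => S k ω')) : ℝ≥0∞) : EReal)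
          - ((1 / 2 : ℝ) : EReal) := by
  open AgeOfInfo in
  have hX1 : ∀ᵐ ω ∂P, ∀ k, 1 ≤ X k ω := ae_all_iff.2 fun k =>
    (hXident k).symm.ae_snd (p := fun n => 1 ≤ n) measurableSet_Ici hXpos
  have hS1 : ∀ᵐ ω ∂P, ∀ k, 1 ≤ S k ω := ae_all_iff.2 fun k =>
    (hSident k).symm.ae_snd (p := fun n => 1 ≤ n) measurableSet_Ici hSpos
  have hm0 : expect P (X 0) ≠ 0 := by
    have : (1 : ℝ≥0∞) ≤ expect P (X 0) := by
      calc (1 : ℝ≥0∞) = ∫⁻ _, 1 ∂P := by simp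
        _ ≤ _ := lintegral_mono_ae (hXpos.mono fun ω h => by exact_mod_cast h)
    exact (zero_lt_one.trans_le this).ne'
  have hlln := fun {G} => ae_tendsto_shift_average (G := G) hXmeas hSmeas hXident hSident hindep
  have hD : Measurable fun y : ℕ ⊕ ℕ → ℕ =>
      minDelay (fun k => y (Sum.inl k)) (fun k => y (Sum.inr k)) :=
    measurable_minDelay (fun k _ => measurable_pi_apply _) (fun k _ => measurable_pi_apply _)
  have hchoose : Measurable fun y : ℕ ⊕ ℕ → ℕ => (y (Sum.inl 0)).choose 2 :=
    (measurable_from_top (f := fun n : ℕ => n.choose 2)).comp (measurable_pi_apply _)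
  have hW : Measurable fun ω j => (Sum.elim X S j : Ω → ℕ) ω :=
    measurable_pi_lambda _ (Sum.rec hXmeas hSmeas)
  have hcost : Measurable fun y : ℕ ⊕ ℕ → ℕ => (y (Sum.inl 0)).choose 2 +
      y (Sum.inl 0) * minDelay (fun k => y (Sum.inl k)) (fun k => y (Sum.inr k)) :=
    hchoose.add ((measurable_pi_apply _).mul hD)
  have hcostK : ∀ K, Measurable fun y : ℕ ⊕ ℕ → ℕ => (y (Sum.inl 0)).choose 2 +
      y (Sum.inl 0) * min (minDelay (fun k => y (Sum.inl k)) (fun k => y (Sum.inr k))) K :=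
    fun K => hchoose.add ((measurable_pi_apply _).mul (hD.min measurable_const))
  -- Monotone convergence: the cap is inactive as soon as `K` reaches the delay.
  have hsup : ⨆ K : ℕ, ∫⁻ ω, (((X 0 ω).choose 2 +
        X 0 ω * min (minDelay (fun k => X k ω) (fun k => S k ω)) K : ℕ) : ℝ≥0∞) ∂P =
      ∫⁻ ω, (((X 0 ω).choose 2 +
        X 0 ω * minDelay (fun k => X k ω) (fun k => S k ω) : ℕ) : ℝ≥0∞) ∂P := by
    have hmono : Monotone fun (K : ℕ) ω => (((X 0 ω).choose 2 +
        X 0 ω * min (minDelay (fun k => X k ω) (fun k => S k ω)) K : ℕ) : ℝ≥0∞) :=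
      fun K L hKL ω => Nat.cast_le.2 (by gcongr)
    have hmeas : ∀ K : ℕ, Measurable fun ω => (((X 0 ω).choose 2 +
        X 0 ω * min (minDelay (fun k => X k ω) (fun k => S k ω)) K : ℕ) : ℝ≥0∞) :=
      fun K => measurable_natCast_ennreal ((hcostK K).comp hW)
    rw [← lintegral_iSup hmeas hmono]
    refine lintegral_congr fun ω => le_antisymm (iSup_le fun K => Nat.cast_le.2 ?_)
      (le_iSup_of_le (minDelay (fun k => X k ω) (fun k => S k ω)) (Nat.cast_le.2 ?_))
    · gcongr
      exact min_le_left _ _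
    · simp
  have hmean : ∫⁻ ω, (((X 0 ω).choose 2 +
        X 0 ω * minDelay (fun k => X k ω) (fun k => S k ω) : ℕ) : ℝ≥0∞) ∂P =
      ∫⁻ ω, ((X 0 ω).choose 2 : ℝ≥0∞) ∂P +
        expect P (X 0) * expect P fun ω => minDelay (fun k => X k ω) (fun k => S k ω) := by
    have hmeas : Measurable fun ω => ((X 0 ω).choose 2 : ℝ≥0∞) :=
      measurable_natCast_ennreal (hchoose.comp hW)
    rw [expect, expect, ← lintegral_mul_minDelay hXmeas hSmeas hindep, ← lintegral_add_left hmeas]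
    simp
  -- Since `delay` at `i` is `minDelay` of the sequences shifted by `i`, the averages of gaps, costs
  -- and capped costs are all shift averages.
  filter_upwards [hX1, hS1, hlln (G := fun x _ => x 0) (measurable_pi_apply _),
    hlln (G := fun x s => (x 0).choose 2 + x 0 * minDelay x s) hcost,
    ae_all_iff.2 fun K => hlln (G := fun x s => (x 0).choose 2 + x 0 * min (minDelay x s) K)
      (hcostK K)] with ω hx hs hm hc hcK
  rw [averageAge_eq (tendsto_average_age hx hs a₀ hm0 hXmean hm hc hcK hsup), hmean,
    expect_sq (hXmeas 0), coe_add_sub_half hm0 hXmean]
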